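/- Let $\mathbf X=(X_1,\dots,X_d)$, $d\ge 1$, be a random vector with distribution function (d.f.) $F$ whose margins are identically distributed and continuous, and suppose that $F$ belongs to the domain of attraction of a multivariate extreme value (max-stable) d.f. $G$ on $\mathbb R^d$ with unit Fréchet margins; that is, there are vectors $a_n>0$ and $b_n$ in $\mathbb R^d$ with $F^n(a_n\mathbf x+b_n)\to G(\mathbf x)$ (componentwise operations) at all continuity points $\mathbf x$ of $G$. Let $\mathcal D=\{I_1,\dots,I_s\}$ be a partition of $D=\{1,\dots,d\}$ into nonempty blocks. For $A\subset D$ let $\mathbf X_A$ be the sub-vector of $\mathbf X$ with indices in $A$, let $G_A$ be the corresponding marginal d.f. of $G$, and let $\epsilon_A=-\log G_A(1,\dots,1)$ be the extremal coefficient, i.e. minus the logarithm of $G$ at the point with coordinates $1$ in $A$ and $\infty$ outside $A$. For $x\in\mathbb R$ let $N_x$ be the number of blocks $I_j$ such that $X_i>x$ for at least one $i\in I_j$. Then the fragility index $$FI(\mathbf X,\mathcal D)=\lim_{x\to\infty}E(N_x\mid N_x>0)$$ exists, and the following hold. (i) $\displaystyle 1\le FI(\mathbf X,\mathcal D)\le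 \frac{\sum_{j=1}^s\epsilon_{I_j}}{\max_{1\le j\le s}\epsilon_{I_j}}.$ (ii) $FI(\mathbf X,\mathcal D)=1$ if and only if the blocks are independent in the limit $G$: for a random vector $\mathbf Y$ with d.f. $G$, the sub-vectors $\mathbf Y_{I_1},\dots,\mathbf Y_{I_s}$ are independent. In particular, $FI(\mathbf X,\mathcal D)=1$ if $\mathbf X_{I_1},\dots,\mathbf X_{I_s}$ are independent. (iii) $\displaystyle FI(\mathbf X,\mathcal D)=\frac{\sum_{j=1}^s\epsilon_{I_j}}{\max_{1\le j\le s}\epsilon_{I_j}}$ if and only if the blocks are totally dependent in the sense that, for all $x\in\mathbb R$, $G(x,\dots,x)=\min_{1\le j\le s}G_{I_j}(x,\dots,x)$. -/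

import Mathlib

open MeasureTheory ProbabilityTheory Filter Topology

namespace BlockFI

noncomputable section

variable {ι : Type*} [Fintype ι]

/-- The sub-vector of `y` with indices in `I`. -/
def block (I : Finset ι) (y : ι → ℝ) : I → ℝ := fun i => y i

/-- The (joint) distribution function `x ↦ ν {y | y ≤ x}` of a law `ν` on `ℝ^ι`;
the order is componentwise. -/
def df (ν : Measure (ι → ℝ)) (x : ι → ℝ) : ℝ := ν.real {y | y ≤ x}

/-- The distribution function at a point whose coordinates may be infinite. -/
def dfExt (ν : Measure (ι → ℝ)) (x : ι → EReal) : ℝ := ν.real {y | ∀ i, (y i : EReal) ≤ x i}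

/-- The distribution function of the sub-vector with indices in `I`. -/
def dfBlock (ν : Measure (ι → ℝ)) (I : Finset ι) : (I → ℝ) → ℝ := df (ν.map (block I))

/-- The `i`-th marginal distribution function. -/
def dfMargin (ν : Measure (ι → ℝ)) (i : ι) : ℝ → ℝ := fun x => cdf (ν.map (fun y => y i)) x

/-- All univariate margins are unit Fréchet. -/
def HasUnitFrechetMargins (ν : Measure (ι → ℝ)) : Prop :=
  ∀ i x, dfMargin ν i x = if 0 < x then Real.exp (-(1 / x)) else 0

/-- Multivariate extreme value distribution: nondegenerate margins and max-stability, i.e.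
for all `n ≥ 1` there are `a > 0` and `b` (vectors) with `G(a x + b)^n = G(x)` for all `x`. -/
def IsMEV (ν : Measure (ι → ℝ)) : Prop :=
  (∀ i c, ν.map (fun y => y i) ≠ Measure.dirac c) ∧
  ∀ n : ℕ, 1 ≤ n → ∃ a b : ι → ℝ, (∀ i, 0 < a i) ∧
    ∀ x, df ν (fun i => a i * x i + b i) ^ n = df ν x

/-- The law `ρ` (with d.f. `F`) is in the domain of attraction of the law `ν` (with d.f. `G`):
for suitable vectors `a n > 0` and `b n`, `F(a n x + b n)^n → G(x)` at all continuity points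
`x` of `G`. -/
def InDomainOfAttraction (ρ ν : Measure (ι → ℝ)) : Prop :=
  ∃ a b : ℕ → ι → ℝ, (∀ n i, 0 < a n i) ∧
    ∀ x, ContinuousAt (df ν) x →
      Tendsto (fun n : ℕ => df ρ (fun i => a n i * x i + b n i) ^ n) atTop (𝓝 (df ν x))

/-- Extremal coefficient of the margins in `A`:
minus the logarithm of `G` at the point with coordinates `1` in `A` and `∞` outside `A`. -/
def extremalCoeff [DecidableEq ι] (ν : Measure (ι → ℝ)) (A : Finset ι) : ℝ :=
  -Real.log (dfExt ν (fun i => if i ∈ A then 1 else ⊤))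

variable {Ω : Type*} [DecidableEq ι]

/-- The number of blocks of the partition in which at least one coordinate of `X` exceeds `x`. -/
def numExceed (X : Ω → ι → ℝ) (P : Finpartition (Finset.univ : Finset ι)) (x : ℝ) (ω : Ω) : ℝ :=
  ∑ I ∈ P.parts, Set.indicator {ω' | ¬ block I (X ω') ≤ fun _ => x} (fun _ => (1 : ℝ)) ω

/-- `E(N_x | N_x > 0)`. -/
def condMeanExceed [MeasurableSpace Ω] (μ : Measure Ω) (X : Ω → ι → ℝ)
    (P : Finpartition (Finset.univ : Finset ι)) (x : ℝ) : ℝ :=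
  ∫ ω, numExceed X P x ω ∂(cond μ {ω | 0 < numExceed X P x ω})

/-- The fragility index of `X` relative to the partition `P` exists and equals `L`. -/
def HasFI [MeasurableSpace Ω] (μ : Measure Ω) (X : Ω → ι → ℝ)
    (P : Finpartition (Finset.univ : Finset ι)) (L : ℝ) : Prop :=
  Tendsto (condMeanExceed μ X P) atTop (𝓝 L)

/-- The blocks of `X` are (mutually) independent random vectors. -/
def IndepBlocks [MeasurableSpace Ω] (μ : Measure Ω) (X : Ω → ι → ℝ)
    (P : Finpartition (Finset.univ : Finset ι)) : Prop :=
  iIndepFun (fun (I : P.parts) ω => block I.1 (X ω)) μ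

end

theorem parts_nonempty {d : ℕ} [NeZero d] (P : Finpartition (Finset.univ : Finset (Fin d))) :
    P.parts.Nonempty :=
  P.parts_nonempty Finset.univ_nonempty.ne_empty

end BlockFI

/-!
Write `V_A = -log G_A` for the exponents of the limit law `G` and `ε_A = V_A(1, …, 1)`; all
distribution functions involved are values of `BlockFI.dfOn`, the joint distribution function of
the coordinates in a set `A`.

Max-stability with unit Fréchet margins forces `G_A(n x)^n = G_A(x)` (`BlockFI.dfOn_nat_mul_pow`),
so `V_A(y, …, y) = ε_A / y` on the diagonal (`BlockFI.neg_log_dfOn_const`). The domain of attraction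
hypothesis gives `n (1 - F_A(a_n x + b_n)) → V_A(x)` for every set `A` of coordinates
(`BlockFI.tendsto_mul_one_sub_dfOn`), and it implies that the common margin of `F` has no finite
right endpoint (`BlockFI.lt_one_of_tendsto_mul_one_sub`); otherwise the conditional expectation would
be an integral against the zero measure for all large thresholds. As the margins of `F` coincide, a
threshold `t` can be compared with the normalized levels near `1` in all coordinates at once, and so
`P(X_i > t for some i ∈ A) / P(X_1 > t) → ε_A` (`BlockFI.tendsto_one_sub_dfOn_div`). Since
`E(N_t | N_t > 0) = ∑_j P(X_{I_j} ≰ t) / P(X ≰ t)` (`BlockFI.condMeanExceed_eq`), the fragility index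
exists and equals `∑_j ε_{I_j} / ε_D`.

The bounds follow from `max_j ε_{I_j} ≤ ε_D ≤ ∑_j ε_{I_j}`. The upper one is attained iff
`ε_D = ε_{I_j}` for some `j`, which by the diagonal formula is total dependence. The lower one is
attained iff `∑_j ε_{I_j} = ε_D`. That this forces `G = ∏_j G_{I_j}` everywhere is
`BlockFI.dfOn_univ_eq_prod_iff`: with `N` the number of blocks exceeding a threshold,
`N - 1{N > 0}` decreases in the threshold, so in the limit `∑_j V_{I_j} - V_D` is a nonnegative
antitone function, and it vanishes on the diagonal. The factorization of distribution functions
gives independence because lower orthants form a generating π-system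
(`BlockFI.indepBlocks_of_dfOn_univ_eq_prod`).
-/

namespace BlockFI

/-! ### Distribution functions of sub-vectors -/

section

variable {ι : Type*}

/-- The joint distribution function of the coordinates in `A` under the law `ν`, written as a
function of a full vector `x` of which only the coordinates in `A` matter. All distribution
functions of the problem (joint, of a block, of a margin, with infinite arguments) are instances. -/
def dfOn (ν : Measure (ι → ℝ)) (A : Finset ι) (x : ι → ℝ) : ℝ := ν.real {y | ∀ i ∈ A, y i ≤ x i}

theorem measurableSet_le_on (A : Finset ι) (x : ι → ℝ) :
    MeasurableSet {y : ι → ℝ | ∀ i ∈ A, y i ≤ x i} := by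
  have : {y : ι → ℝ | ∀ i ∈ A, y i ≤ x i} = ⋂ i ∈ A, {y | y i ≤ x i} := by ext; simp
  rw [this]
  exact Finset.measurableSet_biInter _ fun i _ =>
    measurableSet_le (measurable_pi_apply i) measurable_const

theorem dfOn_nonneg (ν : Measure (ι → ℝ)) (A : Finset ι) (x : ι → ℝ) : 0 ≤ dfOn ν A x :=
  measureReal_nonneg

section Probability

variable (ν : Measure (ι → ℝ)) [IsProbabilityMeasure ν]

theorem dfOn_mono (A : Finset ι) {x x' : ι → ℝ} (h : ∀ i ∈ A, x i ≤ x' i) :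
    dfOn ν A x ≤ dfOn ν A x' :=
  measureReal_mono fun _ hy i hi => (hy i hi).trans (h i hi)

theorem dfOn_congr (A : Finset ι) {x x' : ι → ℝ} (h : ∀ i ∈ A, x i = x' i) :
    dfOn ν A x = dfOn ν A x' :=
  le_antisymm (dfOn_mono ν A fun i hi => (h i hi).le) (dfOn_mono ν A fun i hi => (h i hi).ge)

theorem dfOn_anti {A B : Finset ι} (h : A ⊆ B) (x : ι → ℝ) : dfOn ν B x ≤ dfOn ν A x :=
  measureReal_mono fun _ hy i hi => hy i (h hi)

theorem one_sub_dfOn (A : Finset ι) (x : ι → ℝ) :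
    1 - dfOn ν A x = ν.real {y | ∀ i ∈ A, y i ≤ x i}ᶜ :=
  (probReal_compl_eq_one_sub (measurableSet_le_on A x)).symm

theorem dfOn_sub_le [DecidableEq ι] (A B : Finset ι) (x : ι → ℝ) :
    dfOn ν A x - dfOn ν B x ≤ ∑ i ∈ B \ A, (1 - dfOn ν {i} x) := by
  have hsub : {y : ι → ℝ | ∀ i ∈ A, y i ≤ x i} ⊆ {y | ∀ i ∈ B, y i ≤ x i} ∪
      ⋃ i ∈ B \ A, {y | ∀ j ∈ ({i} : Finset ι), y j ≤ x j}ᶜ := by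
    intro y hy
    by_cases hB : ∀ i ∈ B, y i ≤ x i
    · exact Or.inl hB
    · push Not at hB
      obtain ⟨i, hi, hlt⟩ := hB
      refine Or.inr ?_
      simp only [Set.mem_iUnion]
      refine ⟨i, Finset.mem_sdiff.2 ⟨hi, fun hA => (hy i hA).not_gt hlt⟩, ?_⟩
      simpa using hlt
  have h1 := (measureReal_mono (μ := ν) hsub).trans (measureReal_union_le _ _)
  have h2 := measureReal_biUnion_finset_le (μ := ν) (B \ A)
    fun i => {y : ι → ℝ | ∀ j ∈ ({i} : Finset ι), y j ≤ x j}ᶜ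
  simp only [one_sub_dfOn]
  unfold dfOn
  linarith

/-- A distribution function varies at most as much as its margins do together. -/
theorem dfOn_sub_le_sum_abs (A : Finset ι) (x x' : ι → ℝ) :
    dfOn ν A x - dfOn ν A x' ≤ ∑ i ∈ A, |dfOn ν {i} x - dfOn ν {i} x'| := by
  have hsub : {y : ι → ℝ | ∀ i ∈ A, y i ≤ x i} ⊆ {y | ∀ i ∈ A, y i ≤ x' i} ∪
      ⋃ i ∈ A, ({y | ∀ j ∈ ({i} : Finset ι), y j ≤ x j} \
        {y | ∀ j ∈ ({i} : Finset ι), y j ≤ x' j}) := by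
    intro y hy
    by_cases hB : ∀ i ∈ A, y i ≤ x' i
    · exact Or.inl hB
    · push Not at hB
      obtain ⟨i, hi, hlt⟩ := hB
      refine Or.inr ?_
      simp only [Set.mem_iUnion]
      exact ⟨i, hi, by simpa using hy i hi, by simpa using hlt⟩
  have h1 := (measureReal_mono (μ := ν) hsub).trans (measureReal_union_le _ _)
  have h2 := measureReal_biUnion_finset_le (μ := ν) A
    fun i => {y : ι → ℝ | ∀ j ∈ ({i} : Finset ι), y j ≤ x j} \
        {y | ∀ j ∈ ({i} : Finset ι), y j ≤ x' j}
  have h3 : ∀ i ∈ A, ν.real ({y : ι → ℝ | ∀ j ∈ ({i} : Finset ι), y j ≤ x j} \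
        {y | ∀ j ∈ ({i} : Finset ι), y j ≤ x' j}) ≤ |dfOn ν {i} x - dfOn ν {i} x'| := by
    intro i _
    rcases le_total (x i) (x' i) with hle | hle
    · have hempty : {y : ι → ℝ | ∀ j ∈ ({i} : Finset ι), y j ≤ x j} \
          {y | ∀ j ∈ ({i} : Finset ι), y j ≤ x' j} = ∅ := by
        refine Set.sdiff_eq_empty.2 fun y hy j hj => ?_
        obtain rfl := Finset.mem_singleton.1 hj
        exact (hy j hj).trans hle
      rw [hempty]
      simp
    · rw [measureReal_sdiff _ (measurableSet_le_on _ _)]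
      · exact le_abs_self _
      · intro y hy j hj
        obtain rfl := Finset.mem_singleton.1 hj
        exact (hy j hj).trans hle
  have := Finset.sum_le_sum h3
  unfold dfOn at *
  linarith

theorem abs_dfOn_sub_le (A : Finset ι) (x x' : ι → ℝ) :
    |dfOn ν A x - dfOn ν A x'| ≤ ∑ i ∈ A, |dfOn ν {i} x - dfOn ν {i} x'| := by
  refine abs_le'.2 ⟨dfOn_sub_le_sum_abs ν A x x', ?_⟩
  have := dfOn_sub_le_sum_abs ν A x' x
  simp only [abs_sub_comm (dfOn ν _ x')] at this
  linarith

theorem dfMargin_eq_dfOn [Fintype ι] (i : ι) (x : ι → ℝ) : dfMargin ν i (x i) = dfOn ν {i} x := by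
  have : IsProbabilityMeasure (ν.map fun y => y i) :=
    Measure.isProbabilityMeasure_map (measurable_pi_apply i).aemeasurable
  rw [dfMargin, cdf_eq_real, map_measureReal_apply (measurable_pi_apply i) measurableSet_Iic]
  simp [dfOn, Set.preimage]

theorem continuous_dfOn [Fintype ι] (h : ∀ i, Continuous (dfMargin ν i)) (A : Finset ι) :
    Continuous (dfOn ν A) := by
  refine continuous_iff_continuousAt.2 fun x => ?_
  have h0 : Tendsto (fun x' => ∑ i ∈ A, |dfOn ν {i} x' - dfOn ν {i} x|) (𝓝 x) (𝓝 0) := by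
    have : Continuous fun x' : ι → ℝ => ∑ i ∈ A, |dfOn ν {i} x' - dfOn ν {i} x| := by
      simp only [← dfMargin_eq_dfOn ν]
      have := h
      fun_prop
    simpa using this.tendsto x
  refine tendsto_iff_dist_tendsto_zero.2 (squeeze_zero (fun _ => dist_nonneg) (fun x' => ?_) h0)
  exact abs_dfOn_sub_le ν A x' x

/-- Sending the coordinates outside `A` to infinity turns the joint distribution function into
the one of the coordinates in `A`. -/
theorem tendsto_dfOn_univ [Fintype ι] [DecidableEq ι] (A : Finset ι) (x : ι → ℝ) (f : ℕ → ι → ℝ)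
    (hA : ∀ M, ∀ i ∈ A, f M i = x i) (hf : ∀ i ∉ A, Tendsto (fun M => f M i) atTop atTop) :
    Tendsto (fun M => dfOn ν Finset.univ (f M)) atTop (𝓝 (dfOn ν A x)) := by
  have h0 : Tendsto (fun M => dfOn ν A x - ∑ i ∈ Finset.univ \ A, (1 - dfOn ν {i} (f M))) atTop
      (𝓝 (dfOn ν A x - ∑ i ∈ Finset.univ \ A, (1 - 1))) := by
    refine tendsto_const_nhds.sub (tendsto_finsetSum _ fun i hi => tendsto_const_nhds.sub ?_)
    simp only [← dfMargin_eq_dfOn ν]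
    exact (tendsto_cdf_atTop _).comp (hf i (Finset.mem_sdiff.1 hi).2)
  simp only [sub_self, Finset.sum_const_zero, sub_zero] at h0
  refine tendsto_of_tendsto_of_tendsto_of_le_of_le h0 tendsto_const_nhds (fun M => ?_) fun M => ?_
  · have := dfOn_sub_le ν A Finset.univ (f M)
    rw [dfOn_congr ν A (hA M)] at this
    simp only
    linarith
  · exact (dfOn_anti ν (Finset.subset_univ A) _).trans_eq (dfOn_congr ν A (hA M))

end Probability

section Translation

variable (ν : Measure (ι → ℝ))

theorem df_eq_dfOn [Fintype ι] (x : ι → ℝ) : df ν x = dfOn ν Finset.univ x := by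
  simp [df, dfOn, Pi.le_def]

theorem measurable_block (I : Finset ι) : Measurable (block I) :=
  measurable_pi_lambda _ fun i => measurable_pi_apply i.1

theorem block_preimage_Iic (I : Finset ι) (x : I → ℝ) (x' : ι → ℝ) (h : ∀ i : I, x i = x' i) :
    block I ⁻¹' Set.Iic x = {y | ∀ i ∈ I, y i ≤ x' i} := by
  ext y
  simp [block, Pi.le_def, h]

theorem dfBlock_const_eq_dfOn [Fintype ι] (I : Finset ι) (x : ℝ) :
    dfBlock ν I (fun _ => x) = dfOn ν I fun _ => x := by
  rw [dfBlock, df]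
  change (ν.map (block I)).real (Set.Iic _) = _
  rw [map_measureReal_apply (measurable_block I) measurableSet_Iic,
    block_preimage_Iic I _ (fun _ => x) fun _ => rfl, dfOn]

theorem extremalCoeff_eq [Fintype ι] [DecidableEq ι] (A : Finset ι) :
    extremalCoeff ν A = -Real.log (dfOn ν A fun _ => 1) := by
  rw [extremalCoeff, dfExt, dfOn]
  congr 3
  ext y
  refine forall_congr' fun i => ?_
  by_cases h : i ∈ A
  · simp only [h, if_true, forall_true_left]
    exact_mod_cast Iff.rfl
  · simp [h]

end Translation

end

/-! ### Max-stability with unit Fréchet margins -/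

section

variable {ι : Type*} [Fintype ι] {ν : Measure (ι → ℝ)} [IsProbabilityMeasure ν]

theorem HasUnitFrechetMargins.dfOn_singleton (h : HasUnitFrechetMargins ν) (i : ι) (x : ι → ℝ) :
    dfOn ν {i} x = if 0 < x i then Real.exp (-(1 / x i)) else 0 := by
  rw [← dfMargin_eq_dfOn, h]

theorem HasUnitFrechetMargins.dfOn_eq_zero (h : HasUnitFrechetMargins ν) {A : Finset ι}
    {x : ι → ℝ} {i : ι} (hi : i ∈ A) (hx : x i ≤ 0) : dfOn ν A x = 0 := by
  refine le_antisymm ?_ (dfOn_nonneg ν A x)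
  have := dfOn_anti ν (Finset.singleton_subset_iff.2 hi) x
  rwa [h.dfOn_singleton, if_neg hx.not_gt] at this


theorem HasUnitFrechetMargins.continuous_dfOn (h : HasUnitFrechetMargins ν) (A : Finset ι) :
    Continuous (dfOn ν A) := by
  refine BlockFI.continuous_dfOn ν (fun i => ?_) A
  refine continuous_iff_continuousAt.2 fun x => ?_
  have hform : dfMargin ν i = fun x => if 0 < x then Real.exp (-(1 / x)) else 0 := funext (h i)
  rcases lt_trichotomy x 0 with hx | rfl | hx
  · have : (fun x : ℝ => if 0 < x then Real.exp (-(1 / x)) else 0) =ᶠ[𝓝 x] fun _ => 0 := by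
      filter_upwards [gt_mem_nhds hx] with y hy
      rw [if_neg (not_lt.2 (le_of_lt hy))]
    rw [hform]
    exact continuousAt_const.congr this.symm
  · rw [hform, ← continuousWithinAt_univ, ← Set.Iic_union_Ioi (a := (0 : ℝ))]
    refine ContinuousWithinAt.union ?_ ?_
    · refine continuousWithinAt_const.congr (f := fun _ => (0 : ℝ)) (fun y hy => ?_) (by simp)
      rw [if_neg (not_lt.2 hy)]
    · rw [ContinuousWithinAt]
      simp only [lt_irrefl, if_false]
      have : Tendsto (fun y : ℝ => Real.exp (-(1 / y))) (𝓝[>] 0) (𝓝 0) := by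
        refine Real.tendsto_exp_neg_atTop_nhds_zero.comp ?_
        exact tendsto_inv_nhdsGT_zero.congr fun y => (one_div y).symm
      refine this.congr' ?_
      filter_upwards [self_mem_nhdsWithin] with y hy
      rw [if_pos (Set.mem_Ioi.1 hy)]
  · have : (fun x : ℝ => if 0 < x then Real.exp (-(1 / x)) else 0) =ᶠ[𝓝 x]
        fun x => Real.exp (-(1 / x)) := by
      filter_upwards [lt_mem_nhds hx] with y hy
      rw [if_pos hy]
    rw [hform]
    refine ContinuousAt.congr ?_ this.symm
    have := hx.ne'
    fun_prop (disch := assumption)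

/-- Max-stability passes to the distribution functions of sub-vectors, and unit Fréchet margins
force the normalization `a = n`, `b = 0`. -/
theorem dfOn_nat_mul_pow [DecidableEq ι] (hMEV : IsMEV ν) (hF : HasUnitFrechetMargins ν) {n : ℕ}
    (hn : 1 ≤ n) (A : Finset ι) (x : ι → ℝ) :
    dfOn ν A (fun i => n * x i) ^ n = dfOn ν A x := by
  obtain ⟨a, b, ha, hab⟩ := hMEV.2 n hn
  have hsub : ∀ (A : Finset ι) (x : ι → ℝ), dfOn ν A (fun i => a i * x i + b i) ^ n
      = dfOn ν A x := by
    intro A x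
    have h1 := tendsto_dfOn_univ ν A x (fun M i => if i ∈ A then x i else (M : ℝ))
      (fun M i hi => by simp [hi]) (fun i hi => by simpa [hi] using tendsto_natCast_atTop_atTop)
    have h2 := tendsto_dfOn_univ ν A (fun i => a i * x i + b i)
      (fun M i => a i * (if i ∈ A then x i else (M : ℝ)) + b i)
      (fun M i hi => by simp [hi]) (fun i hi => by
        simp only [hi, if_false]
        exact tendsto_atTop_add_const_right _ _
          (tendsto_natCast_atTop_atTop.const_mul_atTop (ha i)))
    refine tendsto_nhds_unique (h2.pow n) (h1.congr fun M => ?_)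
    rw [← df_eq_dfOn, ← df_eq_dfOn, hab]
  have hmargin : ∀ i (y : ℝ), 0 < y → a i * y + b i = n * y := by
    intro i y hy
    have h := hsub {i} fun _ => y
    rw [hF.dfOn_singleton, hF.dfOn_singleton, if_pos hy] at h
    split_ifs at h with hpos
    · rw [← Real.exp_nat_mul, Real.exp_eq_exp] at h
      field_simp at h
      linarith
    · rw [zero_pow (by lia)] at h
      exact absurd h (Real.exp_pos _).ne
  have hna : ∀ i, a i = n ∧ b i = 0 := fun i => by
    have h1 := hmargin i 1 one_pos
    have h2 := hmargin i 2 two_pos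
    constructor <;> linarith
  have := hsub A x
  simpa only [(hna _).1, (hna _).2, add_zero] using this

theorem dfOn_pos [DecidableEq ι] (hMEV : IsMEV ν) (hF : HasUnitFrechetMargins ν) (A : Finset ι)
    {x : ι → ℝ} (hx : ∀ i ∈ A, 0 < x i) : 0 < dfOn ν A x := by
  -- `G_A (n x) → 1`, so it is positive for some `n`, and `G_A x` is a power of it.
  have hlim : Tendsto (fun n : ℕ => 1 - ∑ i ∈ A, (1 - dfOn ν {i} fun j => n * x j)) atTop
      (𝓝 (1 - ∑ i ∈ A, (1 - 1))) := by
    refine tendsto_const_nhds.sub (tendsto_finsetSum _ fun i hi => tendsto_const_nhds.sub ?_)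
    have : ∀ n : ℕ, dfMargin ν i (n * x i) = dfOn ν {i} fun j => n * x j := fun n =>
      dfMargin_eq_dfOn ν i fun j => n * x j
    simp only [← this]
    exact (tendsto_cdf_atTop _).comp (tendsto_natCast_atTop_atTop.atTop_mul_const (hx i hi))
  simp only [sub_self, Finset.sum_const_zero, sub_zero] at hlim
  obtain ⟨n, hn, hn1⟩ := ((hlim.eventually (lt_mem_nhds one_pos)).and (eventually_ge_atTop 1)).exists
  have h := dfOn_sub_le ν ∅ A fun j => n * x j
  rw [Finset.sdiff_empty] at h
  have h0 : dfOn ν ∅ (fun j => n * x j) = 1 := by simp [dfOn]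
  rw [← dfOn_nat_mul_pow hMEV hF hn1]
  exact pow_pos (by linarith) n

/-- On the diagonal, the distribution function of a sub-vector is a Fréchet distribution function
whose scale is the extremal coefficient. -/
theorem neg_log_dfOn_const [DecidableEq ι] (hMEV : IsMEV ν) (hF : HasUnitFrechetMargins ν)
    (A : Finset ι) {y : ℝ} (hy : 0 < y) :
    -Real.log (dfOn ν A fun _ => y) = extremalCoeff ν A / y := by
  have hhom : ∀ (n : ℕ) (z : ℝ), 1 ≤ n →
      n * -Real.log (dfOn ν A fun _ => n * z) = -Real.log (dfOn ν A fun _ => z) := by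
    intro n z hn
    rw [← dfOn_nat_mul_pow hMEV hF hn A fun _ => z, Real.log_pow]
    ring
  have hanti : ∀ z w : ℝ, 0 < z → z ≤ w →
      -Real.log (dfOn ν A fun _ => w) ≤ -Real.log (dfOn ν A fun _ => z) := fun z w hz hzw =>
    neg_le_neg (Real.log_le_log (dfOn_pos hMEV hF A fun _ _ => hz)
      (dfOn_mono ν A fun _ _ => hzw))
  have hnat : ∀ n : ℕ, 1 ≤ n → -Real.log (dfOn ν A fun _ => n) = extremalCoeff ν A / n := by
    intro n hn
    have h := hhom n 1 hn
    have : (0 : ℝ) < n := by exact_mod_cast hn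
    rw [extremalCoeff_eq, ← h]
    field_simp
  -- Squeeze `n * y` between `⌊n * y⌋` and `⌊n * y⌋ + 1`.
  have hfl : Tendsto (fun n : ℕ => (⌊y * (n : ℝ)⌋₊ : ℝ) / n) atTop (𝓝 y) :=
    (tendsto_nat_floor_mul_div_atTop hy.le).comp tendsto_natCast_atTop_atTop
  have hfl' : Tendsto (fun n : ℕ => ((⌊y * (n : ℝ)⌋₊ : ℝ) / n + 1 / n)) atTop (𝓝 y) := by
    simpa using hfl.add tendsto_one_div_atTop_nhds_zero_nat
  have hlarge : ∀ᶠ n : ℕ in atTop, 1 ≤ n ∧ 1 ≤ ⌊y * (n : ℝ)⌋₊ :=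
    (eventually_ge_atTop 1).and ((tendsto_nat_floor_atTop.comp
      (tendsto_natCast_atTop_atTop.const_mul_atTop hy)).eventually_ge_atTop 1)
  have hup : Tendsto (fun n : ℕ => extremalCoeff ν A / ((⌊y * (n : ℝ)⌋₊ : ℝ) / n)) atTop
      (𝓝 (extremalCoeff ν A / y)) := tendsto_const_nhds.div hfl hy.ne'
  have hlo : Tendsto (fun n : ℕ => extremalCoeff ν A / ((⌊y * (n : ℝ)⌋₊ : ℝ) / n + 1 / n)) atTop
      (𝓝 (extremalCoeff ν A / y)) := tendsto_const_nhds.div hfl' hy.ne'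
  refine le_antisymm (ge_of_tendsto hup ?_) (le_of_tendsto hlo ?_)
  · filter_upwards [hlarge] with n ⟨hn, hm⟩
    have hn0 : (0 : ℝ) < n := by exact_mod_cast hn
    have hm0 : (0 : ℝ) < ⌊y * (n : ℝ)⌋₊ := by exact_mod_cast hm
    have h := hanti _ ((n : ℝ) * y) hm0 (by
      rw [mul_comm]; exact Nat.floor_le (by positivity))
    rw [hnat _ hm] at h
    rw [← hhom n y hn]
    calc _ ≤ n * (extremalCoeff ν A / ⌊y * (n : ℝ)⌋₊) := by gcongr
      _ = _ := by field_simp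
  · filter_upwards [hlarge] with n ⟨hn, hm⟩
    have hn0 : (0 : ℝ) < n := by exact_mod_cast hn
    have h := hanti ((n : ℝ) * y) ((⌊y * (n : ℝ)⌋₊ + 1 : ℕ) : ℝ) (by positivity) (by
      push_cast; rw [mul_comm]; exact (Nat.lt_floor_add_one _).le)
    rw [hnat _ (by lia)] at h
    rw [← hhom n y hn]
    calc _ = n * (extremalCoeff ν A / ((⌊y * (n : ℝ)⌋₊ + 1 : ℕ) : ℝ)) := by
          push_cast; field_simp
      _ ≤ _ := by gcongr

theorem dfOn_const_eq_exp [DecidableEq ι] (hMEV : IsMEV ν) (hF : HasUnitFrechetMargins ν)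
    (A : Finset ι) {y : ℝ} (hy : 0 < y) :
    dfOn ν A (fun _ => y) = Real.exp (-(extremalCoeff ν A / y)) := by
  rw [← neg_log_dfOn_const hMEV hF A hy, neg_neg,
    Real.exp_log (dfOn_pos hMEV hF A fun _ _ => hy)]

theorem extremalCoeff_singleton [DecidableEq ι] (hF : HasUnitFrechetMargins ν) (i : ι) :
    extremalCoeff ν {i} = 1 := by
  rw [extremalCoeff_eq, hF.dfOn_singleton]
  simp

theorem extremalCoeff_mono [DecidableEq ι] (hMEV : IsMEV ν) (hF : HasUnitFrechetMargins ν)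
    {A B : Finset ι} (h : A ⊆ B) : extremalCoeff ν A ≤ extremalCoeff ν B := by
  rw [extremalCoeff_eq, extremalCoeff_eq]
  exact neg_le_neg (Real.log_le_log (dfOn_pos hMEV hF B fun _ _ => one_pos) (dfOn_anti ν h _))

theorem one_le_extremalCoeff [DecidableEq ι] (hMEV : IsMEV ν) (hF : HasUnitFrechetMargins ν)
    {A : Finset ι} (hA : A.Nonempty) : 1 ≤ extremalCoeff ν A := by
  obtain ⟨i, hi⟩ := hA
  rw [← extremalCoeff_singleton hF i]
  exact extremalCoeff_mono hMEV hF (Finset.singleton_subset_iff.2 hi)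

end

/-! ### Tails of sub-vectors in the domain of attraction -/

section

theorem tendsto_mul_one_sub_of_tendsto_pow {p : ℕ → ℝ} (hp0 : ∀ n, 0 ≤ p n)
    {g : ℝ} (hg : 0 < g) (h : Tendsto (fun n => p n ^ n) atTop (𝓝 g)) :
    Tendsto (fun n : ℕ => n * (1 - p n)) atTop (𝓝 (-Real.log g)) := by
  have hlog : Tendsto (fun n : ℕ => n * -Real.log (p n)) atTop (𝓝 (-Real.log g)) := by
    refine ((h.log hg.ne').neg).congr fun n => ?_
    rw [Real.log_pow]
    ring
  have hpos : ∀ᶠ n in atTop, 0 < p n := by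
    filter_upwards [h.eventually (lt_mem_nhds hg), eventually_ge_atTop 1] with n hn hn1
    refine (hp0 n).lt_of_ne fun h0 => ?_
    rw [← h0, zero_pow (by lia)] at hn
    exact hn.false
  have hlog0 : Tendsto (fun n => Real.log (p n)) atTop (𝓝 0) := by
    have := (hlog.mul tendsto_one_div_atTop_nhds_zero_nat).neg
    simp only [mul_zero, neg_zero] at this
    refine this.congr' ?_
    filter_upwards [eventually_ge_atTop 1] with n hn
    have : (0 : ℝ) < n := by exact_mod_cast hn
    field_simp
  have hp : Tendsto p atTop (𝓝 1) := by
    have := (Real.continuous_exp.tendsto 0).comp hlog0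
    rw [Real.exp_zero] at this
    refine this.congr' ?_
    filter_upwards [hpos] with n hn
    exact Real.exp_log hn
  have hlow := hlog.mul hp
  rw [mul_one] at hlow
  -- `-p log p ≤ 1 - p ≤ -log p`.
  refine tendsto_of_tendsto_of_tendsto_of_le_of_le' hlow hlog ?_ ?_
  · filter_upwards [hpos] with n hn
    have h1 := Real.one_sub_inv_le_log_of_pos hn
    have h2 : p n * (1 - (p n)⁻¹) ≤ p n * Real.log (p n) := by gcongr
    have h3 : p n * (1 - (p n)⁻¹) = p n - 1 := by field_simp
    have : (n : ℝ) * (-(p n * Real.log (p n))) ≤ n * (1 - p n) := by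
      gcongr
      linarith
    linarith only [this]
  · filter_upwards [hpos] with n hn
    have h1 := Real.log_le_sub_one_of_pos hn
    gcongr
    linarith

variable {ι : Type*} [Fintype ι] [DecidableEq ι] {ρ ν : Measure (ι → ℝ)}
  [IsProbabilityMeasure ρ] [IsProbabilityMeasure ν]

/-- Convergence to `ν` under normalization passes to sub-vectors, here in its tail form. The
coordinates outside `A` are placed at a large `M`, which costs at most `d / M` in the limit. -/
theorem tendsto_mul_one_sub_dfOn (hMEV : IsMEV ν) (hF : HasUnitFrechetMargins ν)
    {u : ℕ → (ι → ℝ) → ι → ℝ} (hu : ∀ n x x' i, x i = x' i → u n x i = u n x' i)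
    (hconv : ∀ x, Tendsto (fun n => dfOn ρ Finset.univ (u n x) ^ n) atTop
      (𝓝 (dfOn ν Finset.univ x)))
    (A : Finset ι) {x : ι → ℝ} (hx : ∀ i ∈ A, 0 < x i) :
    Tendsto (fun n : ℕ => n * (1 - dfOn ρ A (u n x))) atTop (𝓝 (-Real.log (dfOn ν A x))) := by
  have hfull : ∀ z : ι → ℝ, (∀ i, 0 < z i) →
      Tendsto (fun n : ℕ => n * (1 - dfOn ρ Finset.univ (u n z))) atTop
        (𝓝 (-Real.log (dfOn ν Finset.univ z))) := fun z hz =>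
    tendsto_mul_one_sub_of_tendsto_pow (fun n => dfOn_nonneg _ _ _)
      (dfOn_pos hMEV hF _ fun i _ => hz i) (hconv z)
  -- The upper bound holds for every set of coordinates.
  have hupper : ∀ (B : Finset ι) (z : ι → ℝ), (∀ i ∈ B, 0 < z i) → ∀ c,
      -Real.log (dfOn ν B z) < c → ∀ᶠ n : ℕ in atTop, n * (1 - dfOn ρ B (u n z)) < c := by
    intro B z hz c hc
    let f : ℕ → ι → ℝ := fun M i => if i ∈ B then z i else (M : ℝ)
    have hf : ∀ M, ∀ i ∈ B, f M i = z i := fun M i hi => by simp [f, hi]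
    have h1 := tendsto_dfOn_univ ν B z f hf
      (fun i hi => by simpa [f, hi] using tendsto_natCast_atTop_atTop)
    have h2 := ((h1.log (dfOn_pos hMEV hF B hz).ne').neg).eventually (gt_mem_nhds hc)
    obtain ⟨M, hM, hM1⟩ := (h2.and (eventually_ge_atTop 1)).exists
    have hMpos : ∀ i, 0 < f M i := by
      intro i
      by_cases hi : i ∈ B
      · rw [hf M i hi]; exact hz i hi
      · simp only [f, hi, if_false]; exact_mod_cast hM1
    filter_upwards [(hfull (f M) hMpos).eventually (gt_mem_nhds hM)] with n hn
    refine lt_of_le_of_lt ?_ hn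
    have h3 := dfOn_anti ρ (Finset.subset_univ B) (u n (f M))
    rw [dfOn_congr ρ B fun i hi => hu n (f M) z i (hf M i hi)] at h3
    gcongr
  refine tendsto_order.2 ⟨fun c hc => ?_, hupper A x hx⟩
  have hcard : Tendsto (fun M : ℕ => ∑ i ∈ Finset.univ \ A, 2 * (1 / (M : ℝ))) atTop (𝓝 0) := by
    have := tendsto_finsetSum (Finset.univ \ A) fun i _ =>
      (tendsto_one_div_atTop_nhds_zero_nat (𝕜 := ℝ)).const_mul 2
    simpa using this
  obtain ⟨M, hM, hM1⟩ := ((hcard.eventually (gt_mem_nhds (sub_pos.2 hc))).and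
    (eventually_ge_atTop 1)).exists
  have hM0 : (0 : ℝ) < M := by exact_mod_cast hM1
  let f : ι → ℝ := fun i => if i ∈ A then x i else (M : ℝ)
  have hf : ∀ i ∈ A, f i = x i := fun i hi => by simp [f, hi]
  have hfpos : ∀ i, 0 < f i := by
    intro i
    by_cases hi : i ∈ A
    · rw [hf i hi]; exact hx i hi
    · simpa only [f, hi, if_false]
  have hVmono : -Real.log (dfOn ν A x) ≤ -Real.log (dfOn ν Finset.univ f) := by
    rw [← dfOn_congr ν A hf]
    exact neg_le_neg (Real.log_le_log (dfOn_pos hMEV hF _ fun i _ => hfpos i)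
      (dfOn_anti ν (Finset.subset_univ A) f))
  have hsingle : ∀ᶠ n : ℕ in atTop, ∀ i ∈ Finset.univ \ A,
      n * (1 - dfOn ρ {i} (u n f)) < 2 * (1 / (M : ℝ)) := by
    refine (Filter.eventually_all_finset _).2 fun i hi => hupper {i} f (fun i _ => hfpos i) _ ?_
    rw [hF.dfOn_singleton, if_pos (hfpos i), Real.log_exp, neg_neg]
    simp only [f, (Finset.mem_sdiff.1 hi).2, if_false]
    have : (0 : ℝ) < 1 / M := by positivity
    linarith
  filter_upwards [hsingle, (hfull f hfpos).eventually (lt_mem_nhds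
    (a := c + ∑ i ∈ Finset.univ \ A, 2 * (1 / (M : ℝ))) (by linarith))] with n hn1 hn2
  have h1 := Finset.sum_le_sum fun i hi => (hn1 i hi).le
  have h2 := mul_le_mul_of_nonneg_left (dfOn_sub_le ρ A Finset.univ (u n f)) n.cast_nonneg
  rw [Finset.mul_sum, dfOn_congr ρ A fun i hi => hu n f x i (hf i hi)] at h2
  nlinarith

end

/-! ### The right endpoint and the ratios of tails -/

section

/-- A distribution function attracted to the unit Fréchet law has no finite right endpoint.
Comparing the normalizations at `2 n` and `n` shows that `a (2 n)` is about `2 * a n` and that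
`b (2 n) - b n` is small compared with `a n`; if `ω` were an upper endpoint, `(ω - b n) / a n`
would have to tend to infinity, yet it does not increase from `n` to `2 n`. -/
theorem lt_one_of_tendsto_mul_one_sub {H : ℝ → ℝ} (hH : Monotone H) (hH1 : ∀ x, H x ≤ 1)
    {a b : ℕ → ℝ} (ha : ∀ n, 0 < a n)
    (h : ∀ y, 0 < y → Tendsto (fun n : ℕ => n * (1 - H (a n * y + b n))) atTop (𝓝 (1 / y)))
    (ω : ℝ) : H ω < 1 := by
  by_contra! hω
  have hlt : ∀ y, 0 < y → ∀ᶠ n in atTop, a n * y + b n < ω := by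
    intro y hy
    filter_upwards [(h y hy).eventually (lt_mem_nhds (one_div_pos.2 hy))] with n hn
    by_contra! hle
    have h1 : H (a n * y + b n) = 1 := le_antisymm (hH1 _) (hω.trans (hH hle))
    rw [h1] at hn
    simp at hn
  have hdouble : ∀ x, 0 < x →
      Tendsto (fun n : ℕ => n * (1 - H (a (2 * n) * x + b (2 * n)))) atTop (𝓝 (1 / (2 * x))) := by
    intro x hx
    have h1 := ((h x hx).comp (tendsto_id.const_mul_atTop' (r := 2) two_pos)).const_mul (1 / 2)
    refine (h1.congr fun n => ?_).trans_eq ?_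
    · simp only [Function.comp, id]
      push_cast
      ring
    · congr 1
      field_simp
  have hbelow : ∀ x y, 0 < y → y < 2 * x →
      ∀ᶠ n in atTop, a n * y + b n < a (2 * n) * x + b (2 * n) := by
    intro x y hy hyx
    filter_upwards [(hdouble x (by linarith)).eventually_lt (h y hy)
      (one_div_lt_one_div_of_lt hy hyx)] with n hn
    by_contra! hle
    have := hH hle
    have h2 : (n : ℝ) * (1 - H (a n * y + b n)) ≤ n * (1 - H (a (2 * n) * x + b (2 * n))) := by
      gcongr
    linarith
  have habove : ∀ x y, 0 < x → 2 * x < y →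
      ∀ᶠ n in atTop, a (2 * n) * x + b (2 * n) < a n * y + b n := by
    intro x y hx hyx
    filter_upwards [(h y (by linarith)).eventually_lt (hdouble x hx)
      (one_div_lt_one_div_of_lt (by linarith) hyx)] with n hn
    by_contra! hle
    have := hH hle
    have h2 : (n : ℝ) * (1 - H (a (2 * n) * x + b (2 * n))) ≤ n * (1 - H (a n * y + b n)) := by
      gcongr
    linarith
  -- Brackets for the levels of `x = 1` and `x = 2` at `2 n`, tight enough to give
  -- `a (2 n) ≥ 7/4 * a n` and `b (2 n) ≥ b n - 3/8 * a n`.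
  obtain ⟨N, hN⟩ := eventually_atTop.1 ((hbelow 1 (2 - 1 / 8) (by norm_num) (by norm_num)).and
    ((habove 1 (2 + 1 / 8) (by norm_num) (by norm_num)).and
    ((hbelow 2 (4 - 1 / 8) (by norm_num) (by norm_num)).and
    ((habove 2 (4 + 1 / 8) (by norm_num) (by norm_num)).and (eventually_ge_atTop 1)))))
  set r := max 1 ((ω - b N) / a N) with hr
  have hr1 : 1 ≤ r := le_max_left _ _
  have hN1 : 1 ≤ N := (hN N le_rfl).2.2.2.2
  have hinv : ∀ k : ℕ, N ≤ 2 ^ k * N ∧ ω - b (2 ^ k * N) ≤ r * a (2 ^ k * N) := by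
    intro k
    induction k with
    | zero =>
      simp only [pow_zero, one_mul, le_refl, true_and]
      rw [← div_le_iff₀ (ha N)]
      exact le_max_right _ _
    | succ k ih =>
      obtain ⟨hk, ih⟩ := ih
      rw [pow_succ', mul_assoc]
      refine ⟨by lia, ?_⟩
      obtain ⟨h1, h2, h3, h4, -⟩ := hN _ hk
      have hak := ha (2 ^ k * N)
      have ha2 : 7 / 4 * a (2 ^ k * N) ≤ a (2 * (2 ^ k * N)) := by linarith
      have hb2 : b (2 ^ k * N) - 3 / 8 * a (2 ^ k * N) ≤ b (2 * (2 ^ k * N)) := by linarith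
      nlinarith
  obtain ⟨M, hM⟩ := eventually_atTop.1 (hlt r (by linarith))
  have hMN : M ≤ 2 ^ M * N := M.lt_two_pow_self.le.trans (Nat.le_mul_of_pos_right _ hN1)
  have h1 := hM _ hMN
  have h2 := (hinv M).2
  linarith

variable {ι : Type*} [Fintype ι] [DecidableEq ι] {ρ ν : Measure (ι → ℝ)}
  [IsProbabilityMeasure ρ] [IsProbabilityMeasure ν]

/-- The extremal coefficient of `A` is the limiting ratio of the probability that some coordinate
in `A` exceeds `t` to the probability that a given coordinate does. With `n = ⌊1 / P(X_i > t)⌋`,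
the threshold `t` eventually lies between the normalized levels of `1 - δ` and `1 + δ` in every
coordinate, because all coordinates have the same tail. -/
theorem tendsto_one_sub_dfOn_div (hMEV : IsMEV ν) (hF : HasUnitFrechetMargins ν)
    (hDoA : InDomainOfAttraction ρ ν) {H : ℝ → ℝ} (hH : Monotone H) (hH1 : ∀ x, H x ≤ 1)
    (hHlim : Tendsto H atTop (𝓝 1)) (hρ : ∀ i x, dfOn ρ {i} x = H (x i)) [Nonempty ι]
    (A : Finset ι) :
    (∀ t, H t < 1) ∧
    Tendsto (fun t => (1 - dfOn ρ A fun _ => t) / (1 - H t)) atTop (𝓝 (extremalCoeff ν A)) := by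
  obtain ⟨a, b, ha, hab⟩ := hDoA
  let u : ℕ → (ι → ℝ) → ι → ℝ := fun n x i => a n i * x i + b n i
  have htail : ∀ (A : Finset ι) (y : ℝ), 0 < y →
      Tendsto (fun n : ℕ => n * (1 - dfOn ρ A (u n fun _ => y))) atTop
        (𝓝 (extremalCoeff ν A / y)) := by
    intro A y hy
    rw [← neg_log_dfOn_const hMEV hF A hy]
    refine tendsto_mul_one_sub_dfOn hMEV hF (u := u) (fun n x x' i h => by simp only [u, h])
      (fun x => ?_) A fun _ _ => hy
    simp only [← df_eq_dfOn]
    refine hab x (Continuous.continuousAt ?_)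
    exact (hF.continuous_dfOn Finset.univ).congr fun x => (df_eq_dfOn ν x).symm
  have htail1 : ∀ i (y : ℝ), 0 < y →
      Tendsto (fun n : ℕ => n * (1 - H (a n i * y + b n i))) atTop (𝓝 (1 / y)) := by
    intro i y hy
    have := htail {i} y hy
    simpa only [hρ, extremalCoeff_singleton hF] using this
  have hlt : ∀ t, H t < 1 := by
    obtain ⟨i⟩ := ‹Nonempty ι›
    exact lt_one_of_tendsto_mul_one_sub hH hH1 (fun n => ha n i) (htail1 i)
  refine ⟨hlt, ?_⟩
  have hinv : Tendsto (fun t => (1 - H t)⁻¹) atTop atTop := by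
    refine tendsto_inv_nhdsGT_zero.comp (tendsto_nhdsWithin_iff.2 ⟨?_, ?_⟩)
    · simpa using hHlim.const_sub 1
    · exact Eventually.of_forall fun t => sub_pos.2 (hlt t)
  let m : ℝ → ℕ := fun t => ⌊(1 - H t)⁻¹⌋₊
  have hm : Tendsto m atTop atTop := tendsto_nat_floor_atTop.comp hinv
  have hmp : Tendsto (fun t => (m t : ℝ) * (1 - H t)) atTop (𝓝 1) := by
    refine ((tendsto_nat_floor_div_atTop (R := ℝ)).comp hinv).congr fun t => ?_
    simp [m]
  have hlow : ∀ y, 0 < y → y < 1 → ∀ᶠ t in atTop, ∀ i, a (m t) i * y + b (m t) i ≤ t := by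
    intro y hy hy1
    refine eventually_all.2 fun i => ?_
    filter_upwards [hmp.eventually_lt ((htail1 i y hy).comp hm) (one_lt_one_div hy hy1)] with t ht
    by_contra! hle
    have h1 := hH hle.le
    have h2 : (m t : ℝ) * (1 - H (a (m t) i * y + b (m t) i)) ≤ m t * (1 - H t) := by gcongr
    simp only [Function.comp] at ht
    linarith
  have hup : ∀ y, 1 < y → ∀ᶠ t in atTop, ∀ i, t ≤ a (m t) i * y + b (m t) i := by
    intro y hy1
    have hy : 0 < y := by linarith
    refine eventually_all.2 fun i => ?_
    filter_upwards [((htail1 i y hy).comp hm).eventually_lt hmp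
      ((div_lt_one hy).2 hy1)] with t ht
    by_contra! hle
    have h1 := hH hle.le
    have h2 : (m t : ℝ) * (1 - H t) ≤ m t * (1 - H (a (m t) i * y + b (m t) i)) := by gcongr
    simp only [Function.comp] at ht
    linarith
  have hdiv : ContinuousAt (fun y => extremalCoeff ν A / y) 1 := by
    fun_prop (disch := norm_num)
  have hQ : Tendsto (fun t => (m t : ℝ) * (1 - dfOn ρ A fun _ => t)) atTop
      (𝓝 (extremalCoeff ν A)) := by
    refine tendsto_order.2 ⟨fun c hc => ?_, fun c hc => ?_⟩
    · have h1 : ∀ᶠ y in 𝓝[>] (1 : ℝ), c < extremalCoeff ν A / y :=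
        (hdiv.eventually (lt_mem_nhds (by simpa using hc))).filter_mono nhdsWithin_le_nhds
      obtain ⟨y, hy, hy1⟩ := (h1.and self_mem_nhdsWithin).exists
      have hy1 : 1 < y := hy1
      filter_upwards [hup y hy1, ((htail A y (by linarith)).comp hm).eventually
        (lt_mem_nhds hy)] with t ht1 ht2
      refine ht2.trans_le ?_
      have := dfOn_mono ρ A (x := fun _ => t) (x' := u (m t) fun _ => y) fun i _ => ht1 i
      simp only [Function.comp]
      gcongr
    · have h1 : ∀ᶠ y in 𝓝[<] (1 : ℝ), extremalCoeff ν A / y < c :=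
        (hdiv.eventually (gt_mem_nhds (by simpa using hc))).filter_mono nhdsWithin_le_nhds
      have h2 : ∀ᶠ y in 𝓝[<] (1 : ℝ), 0 < y :=
        (lt_mem_nhds one_pos).filter_mono nhdsWithin_le_nhds
      obtain ⟨y, ⟨hy, hy0⟩, hy1⟩ := ((h1.and h2).and self_mem_nhdsWithin).exists
      have hy1 : y < 1 := hy1
      filter_upwards [hlow y hy0 hy1, ((htail A y hy0).comp hm).eventually
        (gt_mem_nhds hy)] with t ht1 ht2
      refine lt_of_le_of_lt ?_ ht2
      have := dfOn_mono ρ A (x := u (m t) fun _ => y) (x' := fun _ => t) fun i _ => ht1 i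
      simp only [Function.comp]
      gcongr
  have := hQ.div hmp one_ne_zero
  rw [div_one] at this
  refine this.congr' ?_
  filter_upwards [hm.eventually_ge_atTop 1] with t ht
  have h0 : (0 : ℝ) < m t := by exact_mod_cast ht
  have h1 : 0 < 1 - H t := sub_pos.2 (hlt t)
  simp only [Pi.div_apply]
  field_simp

end

/-! ### Union bounds over a cover of the coordinates -/

section Cover

variable {ι : Type*} [Fintype ι] (ν : Measure (ι → ℝ)) [IsProbabilityMeasure ν]
  {S : Finset (Finset ι)}

theorem one_sub_dfOn_univ_le_sum (hS : ∀ i, ∃ I ∈ S, i ∈ I) (x : ι → ℝ) :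
    1 - dfOn ν Finset.univ x ≤ ∑ I ∈ S, (1 - dfOn ν I x) := by
  simp only [one_sub_dfOn]
  refine (measureReal_mono (fun y hy => ?_) (measure_ne_top _ _)).trans
    (measureReal_biUnion_finset_le S _)
  simp only [Set.mem_compl_iff, Set.mem_ofPred_eq, not_forall] at hy
  obtain ⟨i, _, hi⟩ := hy
  obtain ⟨I, hI, hiI⟩ := hS i
  simp only [Set.mem_iUnion]
  exact ⟨I, hI, fun h => hi (h i hiI)⟩

/-- With `N` the number of blocks in which `x` is exceeded, this says that the expectation of
`N - 1{N > 0}` decreases when the threshold is raised from `c` to `x`. -/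
theorem dfOn_univ_sub_le_sum (hS : ∀ i, ∃ I ∈ S, i ∈ I) {c x : ι → ℝ} (hcx : ∀ i, c i ≤ x i) :
    dfOn ν Finset.univ x - dfOn ν Finset.univ c ≤ ∑ I ∈ S, (dfOn ν I x - dfOn ν I c) := by
  have hdiff : ∀ I : Finset ι, dfOn ν I x - dfOn ν I c =
      ν.real ({y | ∀ i ∈ I, y i ≤ x i} \ {y | ∀ i ∈ I, y i ≤ c i}) := fun I =>
    (measureReal_sdiff (fun y hy i hi => (hy i hi).trans (hcx i)) (measurableSet_le_on I c)).symm
  simp only [hdiff]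
  refine (measureReal_mono (fun y hy => ?_) (measure_ne_top _ _)).trans
    (measureReal_biUnion_finset_le S _)
  obtain ⟨hy1, hy2⟩ := hy
  simp only [Set.mem_ofPred_eq, not_forall] at hy2
  obtain ⟨i, _, hi⟩ := hy2
  obtain ⟨I, hI, hiI⟩ := hS i
  simp only [Set.mem_iUnion]
  exact ⟨I, hI, fun j _ => hy1 j (Finset.mem_univ j), fun h => hi (h i hiI)⟩

end Cover

/-! ### Factorization of the limit distribution function -/

section MaxStable

variable {ι : Type*} [Fintype ι] [DecidableEq ι] {ν : Measure (ι → ℝ)} [IsProbabilityMeasure ν]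
  {S : Finset (Finset ι)}

theorem tendsto_mul_one_sub_dfOn_nat_mul (hMEV : IsMEV ν) (hF : HasUnitFrechetMargins ν)
    (A : Finset ι) {x : ι → ℝ} (hx : ∀ i, 0 < x i) :
    Tendsto (fun n : ℕ => n * (1 - dfOn ν A fun i => n * x i)) atTop
      (𝓝 (-Real.log (dfOn ν A x))) := by
  refine tendsto_mul_one_sub_of_tendsto_pow (fun n => dfOn_nonneg _ _ _)
    (dfOn_pos hMEV hF A fun i _ => hx i) (tendsto_const_nhds.congr' ?_)
  filter_upwards [eventually_ge_atTop 1] with n hn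
  exact (dfOn_nat_mul_pow hMEV hF hn A x).symm

theorem neg_log_dfOn_univ_le_sum (hMEV : IsMEV ν) (hF : HasUnitFrechetMargins ν)
    (hS : ∀ i, ∃ I ∈ S, i ∈ I) {x : ι → ℝ} (hx : ∀ i, 0 < x i) :
    -Real.log (dfOn ν Finset.univ x) ≤ ∑ I ∈ S, -Real.log (dfOn ν I x) := by
  refine le_of_tendsto_of_tendsto' (tendsto_mul_one_sub_dfOn_nat_mul hMEV hF _ hx)
    (tendsto_finsetSum S fun I _ => tendsto_mul_one_sub_dfOn_nat_mul hMEV hF I hx) fun n => ?_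
  rw [← Finset.mul_sum]
  exact mul_le_mul_of_nonneg_left (one_sub_dfOn_univ_le_sum ν hS _) n.cast_nonneg

theorem extremalCoeff_univ_le_sum (hMEV : IsMEV ν) (hF : HasUnitFrechetMargins ν)
    (hS : ∀ i, ∃ I ∈ S, i ∈ I) :
    extremalCoeff ν Finset.univ ≤ ∑ I ∈ S, extremalCoeff ν I := by
  simpa only [extremalCoeff_eq] using
    neg_log_dfOn_univ_le_sum hMEV hF hS (x := fun _ => 1) fun _ => one_pos

theorem sum_neg_log_dfOn_sub_antitone (hMEV : IsMEV ν) (hF : HasUnitFrechetMargins ν)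
    (hS : ∀ i, ∃ I ∈ S, i ∈ I) {c x : ι → ℝ} (hc : ∀ i, 0 < c i) (hcx : ∀ i, c i ≤ x i) :
    -Real.log (dfOn ν Finset.univ c) - -Real.log (dfOn ν Finset.univ x) ≤
      ∑ I ∈ S, (-Real.log (dfOn ν I c) - -Real.log (dfOn ν I x)) := by
  have hlim := fun A => (tendsto_mul_one_sub_dfOn_nat_mul hMEV hF A hc).sub
    (tendsto_mul_one_sub_dfOn_nat_mul hMEV hF A fun i => (hc i).trans_le (hcx i))
  refine le_of_tendsto_of_tendsto' (hlim _) (tendsto_finsetSum S fun I _ => hlim I) fun n => ?_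
  simp only [← mul_sub, ← Finset.mul_sum, sub_sub_sub_cancel_left]
  refine mul_le_mul_of_nonneg_left (dfOn_univ_sub_le_sum ν hS fun i => ?_) n.cast_nonneg
  have := hcx i
  gcongr

/-- Additivity of the extremal coefficients already forces the distribution function to factor
over the blocks: the defect `∑ V_I - V` of the exponents `V = -log G` is nonnegative and antitone,
and at the diagonal point `(c, …, c)` it is `(∑ ε_I - ε) / c = 0`. -/
theorem dfOn_univ_eq_prod_iff (hMEV : IsMEV ν) (hF : HasUnitFrechetMargins ν) [Nonempty ι]
    (hS : ∀ i, ∃ I ∈ S, i ∈ I) :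
    (∀ x, dfOn ν Finset.univ x = ∏ I ∈ S, dfOn ν I x) ↔
      ∑ I ∈ S, extremalCoeff ν I = extremalCoeff ν Finset.univ := by
  have hlogprod : ∀ x : ι → ℝ, (∀ i, 0 < x i) →
      -Real.log (∏ I ∈ S, dfOn ν I x) = ∑ I ∈ S, -Real.log (dfOn ν I x) := by
    intro x hx
    rw [Real.log_prod fun I _ => (dfOn_pos hMEV hF I fun i _ => hx i).ne', Finset.sum_neg_distrib]
  constructor
  · intro h
    simp only [extremalCoeff_eq]
    rw [← hlogprod _ fun _ => one_pos, h]
  · intro h x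
    by_cases hx : ∀ i, 0 < x i
    · obtain ⟨i₀, hi₀⟩ := Finite.exists_min x
      have hanti := sum_neg_log_dfOn_sub_antitone hMEV hF hS (c := fun _ => x i₀)
        (fun _ => hx i₀) hi₀
      simp only [neg_log_dfOn_const hMEV hF _ (hx i₀), Finset.sum_sub_distrib,
        ← Finset.sum_div, h] at hanti
      have hle := neg_log_dfOn_univ_le_sum hMEV hF hS hx
      have heq : -Real.log (dfOn ν Finset.univ x) = -Real.log (∏ I ∈ S, dfOn ν I x) := by
        rw [hlogprod x hx]
        linarith
      exact Real.log_injOn_pos (dfOn_pos hMEV hF _ fun i _ => hx i)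
        (Finset.prod_pos fun I _ => dfOn_pos hMEV hF I fun i _ => hx i) (neg_injective heq)
    · push Not at hx
      obtain ⟨i, hi⟩ := hx
      obtain ⟨I, hI, hiI⟩ := hS i
      rw [hF.dfOn_eq_zero (Finset.mem_univ i) hi,
        Finset.prod_eq_zero hI (hF.dfOn_eq_zero hiI hi)]

end MaxStable

/-! ### The conditional mean number of exceeding blocks -/

section Exceedances

variable {ι Ω : Type*} [Fintype ι] [DecidableEq ι] [MeasurableSpace Ω] {μ : Measure Ω}
  {X : Ω → ι → ℝ}

theorem exists_part_mem (P : Finpartition (Finset.univ : Finset ι)) (i : ι) :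
    ∃ I ∈ P.parts, i ∈ I := P.exists_mem (Finset.mem_univ i)

theorem condMeanExceed_eq [IsProbabilityMeasure μ] (hX : Measurable X) (P : Finpartition (Finset.univ : Finset ι)) (t : ℝ) :
    condMeanExceed μ X P t = (∑ I ∈ P.parts, (1 - dfOn (μ.map X) I fun _ => t)) /
      (1 - dfOn (μ.map X) Finset.univ fun _ => t) := by
  have : IsProbabilityMeasure (μ.map X) := Measure.isProbabilityMeasure_map hX.aemeasurable
  have hset : ∀ I : Finset ι, {ω | ¬ block I (X ω) ≤ fun _ => t} =
      X ⁻¹' {y | ∀ i ∈ I, y i ≤ t}ᶜ := by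
    intro I
    ext ω
    simp [block, Pi.le_def]
  have hmeas : ∀ I : Finset ι, MeasurableSet {ω | ¬ block I (X ω) ≤ fun _ => t} := by
    intro I
    rw [hset]
    exact hX (measurableSet_le_on I fun _ => t).compl
  have hprob : ∀ I : Finset ι, μ.real {ω | ¬ block I (X ω) ≤ fun _ => t} =
      1 - dfOn (μ.map X) I fun _ => t := by
    intro I
    rw [hset, one_sub_dfOn, map_measureReal_apply hX (measurableSet_le_on I _).compl]
  have hnonneg : ∀ ω, 0 ≤ numExceed X P t ω := fun ω =>
    Finset.sum_nonneg fun I _ => Set.indicator_nonneg (fun _ _ => zero_le_one) ω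
  have hevent : {ω | 0 < numExceed X P t ω} =
      {ω | ¬ block Finset.univ (X ω) ≤ fun _ => t} := by
    ext ω
    simp only [Set.mem_ofPred_eq, numExceed]
    rw [Finset.sum_pos_iff_of_nonneg fun I _ => Set.indicator_nonneg (fun _ _ => zero_le_one) ω]
    constructor
    · rintro ⟨I, _, h⟩ hle
      have := Set.mem_of_indicator_ne_zero h.ne'
      exact this fun i => hle ⟨i, Finset.mem_univ _⟩
    · intro h
      simp only [block, Pi.le_def, not_forall] at h
      obtain ⟨i, hi⟩ := h
      obtain ⟨I, hI, hiI⟩ := exists_part_mem P i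
      refine ⟨I, hI, ?_⟩
      rw [Set.indicator_of_mem]
      · exact one_pos
      · exact fun h => hi (h ⟨i, hiI⟩)
  have hint : ∫ ω, numExceed X P t ω ∂μ = ∑ I ∈ P.parts, (1 - dfOn (μ.map X) I fun _ => t) := by
    unfold numExceed
    rw [integral_finsetSum _ fun I _ => (integrable_const (1 : ℝ)).indicator (hmeas I)]
    refine Finset.sum_congr rfl fun I _ => ?_
    rw [integral_indicator_const _ (hmeas I), hprob]
    simp
  rw [condMeanExceed, ProbabilityTheory.cond, integral_smul_measure,
    setIntegral_eq_integral_of_forall_compl_eq_zero, hint, hevent, ENNReal.toReal_inv,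
    ← measureReal_def, hprob, smul_eq_mul, div_eq_inv_mul]
  intro ω hω
  exact le_antisymm (not_lt.1 hω) (hnonneg ω)

theorem IndepBlocks.dfOn_univ_eq_prod (hX : Measurable X)
    {P : Finpartition (Finset.univ : Finset ι)} (h : IndepBlocks μ X P) (x : ι → ℝ) :
    dfOn (μ.map X) Finset.univ x = ∏ I ∈ P.parts, dfOn (μ.map X) I x := by
  have hind := h.measure_inter_preimage_eq_mul Finset.univ
    (sets := fun I : P.parts => Set.Iic fun i : I.1 => x i) fun _ _ => measurableSet_Iic
  have hpre : ∀ I : Finset ι, (fun ω => block I (X ω)) ⁻¹' (Set.Iic fun i : I => x i) =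
      X ⁻¹' {y | ∀ i ∈ I, y i ≤ x i} := by
    intro I
    rw [← block_preimage_Iic I (fun i => x i) x fun _ => rfl]
    rfl
  have hinter : ⋂ I : P.parts, X ⁻¹' {y | ∀ i ∈ I.1, y i ≤ x i} =
      X ⁻¹' {y | ∀ i ∈ (Finset.univ : Finset ι), y i ≤ x i} := by
    ext ω
    simp only [Set.mem_iInter, Set.mem_preimage, Set.mem_ofPred_eq]
    refine ⟨fun h i _ => ?_, fun h I i _ => h i (Finset.mem_univ i)⟩
    obtain ⟨I, hI, hiI⟩ := exists_part_mem P i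
    exact h ⟨I, hI⟩ i hiI
  simp only [hpre, Finset.mem_univ, Set.iInter_true] at hind
  rw [hinter] at hind
  simp only [dfOn, measureReal_def, Measure.map_apply hX (measurableSet_le_on _ x)]
  rw [hind, ENNReal.toReal_prod]
  exact Finset.prod_coe_sort P.parts fun I => (μ (X ⁻¹' {y | ∀ i ∈ I, y i ≤ x i})).toReal

end Exceedances

/-! ### Independence from factorization -/

section Independence

variable {ι : Type*} [Fintype ι] [DecidableEq ι] {ν : Measure (ι → ℝ)} [IsProbabilityMeasure ν]

theorem isCountablySpanning_range_Iic : IsCountablySpanning (Set.range (Set.Iic : ℝ → Set ℝ)) :=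
  ⟨fun n => Set.Iic n, fun n => ⟨n, rfl⟩,
    Set.iUnion_eq_univ_iff.2 fun x => exists_nat_ge x⟩

theorem generateFrom_range_Iic_pi (κ : Type*) [Finite κ] :
    MeasurableSpace.generateFrom (Set.range (Set.Iic : (κ → ℝ) → Set (κ → ℝ))) =
      MeasurableSpace.pi := by
  rw [← generateFrom_eq_pi (C := fun _ : κ => Set.range (Set.Iic : ℝ → Set ℝ))
    (fun _ => (borel_eq_generateFrom_Iic ℝ).symm.trans (BorelSpace.measurable_eq).symm)
    fun _ => isCountablySpanning_range_Iic]
  congr 1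
  ext s
  constructor
  · rintro ⟨x, rfl⟩
    exact ⟨fun i => Set.Iic (x i), fun i _ => ⟨x i, rfl⟩, Set.pi_univ_Iic x⟩
  · rintro ⟨t, ht, rfl⟩
    choose x hx using fun i => ht i (Set.mem_univ i)
    refine ⟨x, ?_⟩
    rw [← Set.pi_univ_Iic, funext hx]

theorem isPiSystem_range_Iic (κ : Type*) :
    IsPiSystem (Set.range (Set.Iic : (κ → ℝ) → Set (κ → ℝ))) := by
  rintro _ ⟨x, rfl⟩ _ ⟨y, rfl⟩ _
  exact ⟨x ⊓ y, Set.Iic_inter_Iic.symm⟩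

/-- Lower orthants `Iic x` of the blocks generate the σ-algebra, so blocks whose joint
distribution function factors are independent. -/
theorem indepBlocks_of_dfOn_univ_eq_prod {P : Finpartition (Finset.univ : Finset ι)}
    (h : ∀ x, dfOn ν Finset.univ x = ∏ I ∈ P.parts, dfOn ν I x) :
    IndepBlocks ν (fun y => y) P := by
  have hb : ∀ I : P.parts, Measurable (block I.1) := fun I => measurable_block I.1
  have hprob : ∀ I : P.parts, IsProbabilityMeasure (ν.map (block I.1)) := fun I =>
    Measure.isProbabilityMeasure_map (hb I).aemeasurable
  have hjoint : Measurable fun (y : ι → ℝ) (I : P.parts) => block I.1 y :=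
    measurable_pi_lambda _ hb
  refine (iIndepFun_iff_map_fun_eq_pi_map fun I => (hb I).aemeasurable).2 (Eq.symm ?_)
  refine Measure.pi_eq_generateFrom
    (C := fun I : P.parts => Set.range (Set.Iic : (I.1 → ℝ) → Set (I.1 → ℝ)))
    (fun I => generateFrom_range_Iic_pi _) (fun I => isPiSystem_range_Iic _)
    (fun I => ⟨fun n => Set.Iic fun _ => n, fun n => ⟨_, rfl⟩, fun n => measure_lt_top _ _,
      Set.iUnion_eq_univ_iff.2 fun x => ?_⟩) fun s hs => ?_
  · obtain ⟨M, hM⟩ := (Set.finite_range x).bddAbove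
    obtain ⟨n, hn⟩ := exists_nat_ge M
    exact ⟨n, fun i => (hM ⟨i, rfl⟩).trans hn⟩
  · choose x hx using hs
    obtain rfl : (fun I => Set.Iic (x I)) = s := funext hx
    choose I hI hiI using exists_part_mem P
    -- Glue the points `x I` into one vector; blocks are disjoint, so it restricts to each `x I`.
    let z : ι → ℝ := fun i => x ⟨I i, hI i⟩ ⟨i, hiI i⟩
    have hz : ∀ (J : P.parts) (j : J.1), x J j = z j := by
      rintro J ⟨j, hj⟩
      obtain rfl : J = ⟨I j, hI j⟩ := Subtype.ext (P.eq_of_mem_parts J.2 (hI j) hj (hiI j))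
      rfl
    have hpre : (fun (y : ι → ℝ) (I : P.parts) => block I.1 y) ⁻¹'
        (Set.univ.pi fun I => Set.Iic (x I)) =
          {y | ∀ i ∈ (Finset.univ : Finset ι), y i ≤ z i} := by
      ext y
      simp only [Set.mem_preimage, Set.mem_univ_pi, Set.mem_Iic, Pi.le_def, hz, block,
        Set.mem_ofPred_eq]
      refine ⟨fun h i _ => h ⟨I i, hI i⟩ ⟨i, hiI i⟩, fun h J j => h j (Finset.mem_univ _)⟩
    rw [Measure.map_apply hjoint (MeasurableSet.univ_pi fun I => measurableSet_Iic), hpre]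
    have hfac : ∀ J : P.parts, ν.map (block J.1) (Set.Iic (x J)) =
        ν {y | ∀ i ∈ J.1, y i ≤ z i} := fun J => by
      rw [Measure.map_apply (hb J) measurableSet_Iic, block_preimage_Iic J.1 _ z (hz J)]
    simp only [hfac]
    rw [← ENNReal.toReal_eq_toReal_iff' (measure_ne_top _ _)
      (ENNReal.prod_ne_top fun J _ => measure_ne_top _ _), ENNReal.toReal_prod]
    refine (h z).trans ?_
    exact (Finset.prod_coe_sort P.parts fun J => dfOn ν J z).symm

end Independence

/-! ### Tails of products of distribution functions -/

/-- Tail ratios add up over a product of distribution functions. -/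
theorem tendsto_one_sub_prod_div {κ : Type*} {S : Finset κ} {F : κ → ℝ → ℝ} {p : ℝ → ℝ}
    {e : κ → ℝ} (hp : Tendsto p atTop (𝓝 0)) (hp0 : ∀ t, p t ≠ 0)
    (h : ∀ k ∈ S, Tendsto (fun t => (1 - F k t) / p t) atTop (𝓝 (e k))) :
    Tendsto (fun t => (1 - ∏ k ∈ S, F k t) / p t) atTop (𝓝 (∑ k ∈ S, e k)) := by
  classical
  induction S using Finset.induction_on with
  | empty => simp
  | insert k S hk ih =>
    have h1 := h k (Finset.mem_insert_self k S)
    have h2 := ih fun j hj => h j (Finset.mem_insert_of_mem hj)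
    have h3 : Tendsto (F k) atTop (𝓝 1) := by
      have := (h1.mul hp).const_sub 1
      rw [mul_zero, sub_zero] at this
      refine this.congr fun t => ?_
      rw [div_mul_cancel₀ _ (hp0 t), sub_sub_cancel]
    have := h1.add (h3.mul h2)
    rw [one_mul] at this
    rw [Finset.sum_insert hk]
    refine this.congr fun t => ?_
    rw [Finset.prod_insert hk]
    ring

end BlockFI

/-! ### The fragility index -/

theorem proposition3p2 {Ω : Type*} [MeasurableSpace Ω] (μ : Measure Ω) [IsProbabilityMeasure μ]
    {d : ℕ} [NeZero d] (X : Ω → Fin d → ℝ) (hX : Measurable X)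
    (hident : ∀ i j, IdentDistrib (fun ω => X ω i) (fun ω => X ω j) μ μ)
    (hcont : ∀ i, Continuous (BlockFI.dfMargin (μ.map X) i))
    (ν : Measure (Fin d → ℝ)) [IsProbabilityMeasure ν]
    (hMEV : BlockFI.IsMEV ν) (hFrechet : BlockFI.HasUnitFrechetMargins ν)
    (hDoA : BlockFI.InDomainOfAttraction (μ.map X) ν)
    (P : Finpartition (Finset.univ : Finset (Fin d))) :
    ∃ FI : ℝ, BlockFI.HasFI μ X P FI ∧
      (1 ≤ FI ∧
        FI ≤ (∑ I ∈ P.parts, BlockFI.extremalCoeff ν I) /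
          P.parts.sup' (BlockFI.parts_nonempty P) (BlockFI.extremalCoeff ν)) ∧
      ((FI = 1 ↔ BlockFI.IndepBlocks ν (fun y => y) P) ∧
        (BlockFI.IndepBlocks μ X P → FI = 1)) ∧
      (FI = (∑ I ∈ P.parts, BlockFI.extremalCoeff ν I) /
          P.parts.sup' (BlockFI.parts_nonempty P) (BlockFI.extremalCoeff ν) ↔
        ∀ x : ℝ, BlockFI.df ν (fun _ => x) =
          P.parts.inf' (BlockFI.parts_nonempty P)
            (fun I => BlockFI.dfBlock ν I (fun _ => x))) := by
  open BlockFI in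
  have hS := exists_part_mem P
  have hprob : IsProbabilityMeasure (μ.map X) := Measure.isProbabilityMeasure_map hX.aemeasurable
  -- The common margin of `X`.
  obtain ⟨H, hHmono, hH1, hHlim, hρ⟩ : ∃ H : ℝ → ℝ, Monotone H ∧ (∀ x, H x ≤ 1) ∧
      Tendsto H atTop (𝓝 1) ∧ ∀ i x, dfOn (μ.map X) {i} x = H (x i) := by
    refine ⟨dfMargin (μ.map X) 0, monotone_cdf _, cdf_le_one _, tendsto_cdf_atTop _,
      fun i x => ?_⟩
    have hmap : ∀ j, (μ.map X).map (fun y => y j) = μ.map fun ω => X ω j := fun j =>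
      Measure.map_map (measurable_pi_apply j) hX
    rw [← dfMargin_eq_dfOn, dfMargin, dfMargin, hmap, hmap, (hident i 0).map_eq]
  have hratio := tendsto_one_sub_dfOn_div hMEV hFrechet hDoA hHmono hH1 hHlim hρ
  have hHlt : ∀ t, 1 - H t ≠ 0 := fun t => (sub_pos.2 ((hratio ∅).1 t)).ne'
  set E := extremalCoeff ν Finset.univ with hE
  have hEpos : 0 < E :=
    one_pos.trans_le (one_le_extremalCoeff hMEV hFrechet Finset.univ_nonempty)
  set M := P.parts.sup' (parts_nonempty P) (extremalCoeff ν) with hM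
  obtain ⟨J, hJ, hJM⟩ := Finset.exists_mem_eq_sup' (parts_nonempty P) (extremalCoeff ν)
  have hMpos : 0 < M := by
    rw [hM, hJM]
    exact one_pos.trans_le (one_le_extremalCoeff hMEV hFrechet (P.nonempty_of_mem_parts hJ))
  have hME : M ≤ E := Finset.sup'_le _ _ fun I _ =>
    extremalCoeff_mono hMEV hFrechet (Finset.subset_univ I)
  have hEsum := extremalCoeff_univ_le_sum hMEV hFrechet hS
  have hsumpos := hEpos.trans_le hEsum
  have hFI1 : (∑ I ∈ P.parts, extremalCoeff ν I) / E = 1 ↔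
      ∀ x, dfOn ν Finset.univ x = ∏ I ∈ P.parts, dfOn ν I x := by
    rw [dfOn_univ_eq_prod_iff hMEV hFrechet hS, div_eq_one_iff_eq hEpos.ne']
  refine ⟨(∑ I ∈ P.parts, extremalCoeff ν I) / E, ?_, ⟨(one_le_div hEpos).2 hEsum, ?_⟩,
    ⟨hFI1.trans ⟨indepBlocks_of_dfOn_univ_eq_prod, fun h x => ?_⟩, fun h => ?_⟩, ?_⟩
  · refine ((tendsto_finsetSum P.parts fun I _ => (hratio I).2).div (hratio Finset.univ).2
      hEpos.ne').congr fun t => ?_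
    rw [condMeanExceed_eq hX, Pi.div_apply, ← Finset.sum_div,
      div_div_div_cancel_right₀ (hHlt t)]
  · exact div_le_div_of_nonneg_left hsumpos.le hMpos hME
  · simpa using IndepBlocks.dfOn_univ_eq_prod measurable_id h x
  · have h1 := tendsto_one_sub_prod_div (p := fun t => 1 - H t)
      (by simpa using hHlim.const_sub 1) hHlt fun I (_ : I ∈ P.parts) => (hratio I).2
    simp only [← h.dfOn_univ_eq_prod hX] at h1
    rw [tendsto_nhds_unique h1 (hratio Finset.univ).2, div_self hEpos.ne']
  · rw [div_eq_div_iff hEpos.ne' hMpos.ne', mul_right_inj' hsumpos.ne', eq_comm]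
    simp only [df_eq_dfOn, dfBlock_const_eq_dfOn]
    constructor
    · intro h x
      have hJx : dfOn ν Finset.univ (fun _ => x) = dfOn ν J fun _ => x := by
        rcases le_or_gt x 0 with hx | hx
        · obtain ⟨j, hj⟩ := P.nonempty_of_mem_parts hJ
          rw [hFrechet.dfOn_eq_zero (Finset.mem_univ j) hx, hFrechet.dfOn_eq_zero hj hx]
        · rw [dfOn_const_eq_exp hMEV hFrechet _ hx, dfOn_const_eq_exp hMEV hFrechet _ hx, ← hE,
            h, hM, hJM]
      refine le_antisymm (Finset.le_inf' _ _ fun I _ => dfOn_anti ν (Finset.subset_univ I) _) ?_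
      rw [hJx]
      exact Finset.inf'_le _ hJ
    · intro h
      obtain ⟨K, hK, hKmin⟩ := Finset.exists_mem_eq_inf' (parts_nonempty P)
        fun I => dfOn ν I fun _ => (1 : ℝ)
      have hEK : E = extremalCoeff ν K := by
        rw [hE, extremalCoeff_eq, extremalCoeff_eq, h 1, hKmin]
      exact le_antisymm (hEK.trans_le (Finset.le_sup' _ hK)) hME
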